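/- Fix an oracle $\alpha\in 2^\omega$. An $\alpha$-computable metric space is a metric space $X$ with a dense sequence $(s_n)_{n\in\omega}$ such that the reals $d(s_m,s_n)$ are $\alpha$-computable uniformly in $m,n$. A name of $x\in X$ is a sequence $p\in\omega^\omega$ with $d(s_{p(n)},s_{p(m)})<2^{-n}$ for all $m\ge n$ and $\lim_n s_{p(n)}=x$. A set $P\subseteq X$ is $\Pi^0_1(\alpha)$ if its complement is the union of an $\alpha$-computable (possibly empty) sequence of rational open balls $B_r(s_n)$. A partial function $f:\subseteq X\to Y$ between $\alpha$-computable metric spaces is $\alpha$-computable if some partial $\alpha$-computable $\Phi:\subseteq\omega^\omega\to\omega^\omega$ maps every name of every $x\in\mathrm{dom}(f)$ to a name of $f(x)$. For $x\in X$ and $y\in Y$ write $y\le_{tt}^{\alpha}x$ if there is a partial $\alpha$-computable $f:\subseteq X\to Y$ with $\Pi^0_1(\alpha)$ domain such that $x\in\mathrm{dom}(f)$ and $f(x)=y$. The $\alpha$-relative $tt$-degree of $x$ is the class of all points $y$ of $\alpha$-computable metric spaces with $y\le_{tt}^\alpha x$ and $x\le_{tt}^\alpha y$, and $\mathcal{D}_{tt}^{\alpha}(X)$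 is the collection of the $\alpha$-relative $tt$-degrees of the points of $X$. The topological dimension $\dim X\in\omega\cup\{\infty\}$ is the least $n\in\omega$ such that every continuous map from a closed subset of $X$ to the sphere $\mathbb{S}^n$ extends continuously to $X$, and $\infty$ if there is no such $n$. Theorem. Let $\alpha$ be any oracle, and let $X$ and $Y$ be Polish spaces, each equipped with a compatible metric and a dense sequence that make it an $\alpha$-computable metric space. (1) If $\dim X<\dim Y$, then $\mathcal{D}_{tt}^{\alpha}(Y)\not\subseteq\mathcal{D}_{tt}^{\alpha}(X)$. (2) In particular, topological dimension is an invariant of relativized $tt$-degree structures: if $\mathcal{D}_{tt}^{\alpha}(X)=\mathcal{D}_{tt}^{\alpha}(Y)$, then $\dim X=\dim Y$. -/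

import Mathlib

universe u v

namespace TTDegree

/-! ### Topological dimension -/

/-- `S` is an absolute extensor of `X`: every continuous map from a closed subset of `X` to `S`
extends continuously to all of `X`. -/
def IsAbsoluteExtensor (S : Type v) [TopologicalSpace S] (X : Type u) [TopologicalSpace X] :
    Prop :=
  ∀ P : Set X, IsClosed P → ∀ f : C(P, S), ∃ g : C(X, S), ∀ x : P, g x = f x

/-- The `n`-sphere, as the unit sphere of `(n + 1)`-dimensional Euclidean space. -/
abbrev Sphere (n : ℕ) : Type :=
  Metric.sphere (0 : EuclideanSpace ℝ (Fin (n + 1))) 1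

/-- The topological (extension) dimension of `X`: the least `n : ℕ` such that the `n`-sphere is an
absolute extensor of `X`, and `⊤` if there is no such `n`. -/
noncomputable def topDim (X : Type u) [TopologicalSpace X] : ℕ∞ :=
  sInf {d : ℕ∞ | ∃ n : ℕ, d = n ∧ IsAbsoluteExtensor (Sphere n) X}

/-! ### Computability relative to an oracle, on `ℕ` and on Baire space -/

/-- The oracle `α`, as the set of basic functions that a computation may call. -/
def oracle (α : ℕ → Bool) : Set (ℕ →. ℕ) :=
  {fun n => Part.some (α n).toNat}

/-- The finite string `p 0, …, p (k - 1)`. -/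
def initSeg (p : ℕ → ℕ) (k : ℕ) : List ℕ :=
  (List.range k).map p

/-- A partial function `Φ` on Baire space is `α`-computable if it is generated by an `α`-computable
map `φ` of finite strings that is monotone for the prefix order: `Φ p = q` iff `q` is the infinite
sequence whose finite initial segments are produced by `φ` from finite initial segments of `p`
(and `Φ p` is undefined if no infinite sequence is produced). -/
def ComputableFunctional (α : ℕ → Bool) (Φ : (ℕ → ℕ) →. (ℕ → ℕ)) : Prop :=
  ∃ φ : List ℕ → List ℕ, ComputableIn (oracle α) φ ∧
    (∀ σ τ : List ℕ, σ <+: τ → φ σ <+: φ τ) ∧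
    ∀ p q : ℕ → ℕ, q ∈ Φ p ↔ ∀ n : ℕ, ∃ k : ℕ, initSeg q n <+: φ (initSeg p k)

/-! ### `α`-computable metric spaces -/

/-- The structure of an `α`-computable metric space on a metric space `X`: a dense sequence whose
pairwise distances are `α`-computable reals, uniformly. Here `f (m, n, k) / 2 ^ k` approximates the
distance of the points number `m` and `n` within `2 ^ (-k)`. -/
structure ComputableMetric (α : ℕ → Bool) (X : Type u) [MetricSpace X] where
  /-- the dense sequence -/
  seq : ℕ → X
  dense : DenseRange seq
  computable_dist : ∃ f : ℕ × ℕ × ℕ → ℕ, ComputableIn (oracle α) f ∧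
    ∀ m n k : ℕ, |dist (seq m) (seq n) - (f (m, n, k) : ℝ) / 2 ^ k| ≤ 1 / 2 ^ k

section

variable {α : ℕ → Bool} {X : Type u} [MetricSpace X] {Y : Type v} [MetricSpace Y]

/-- `p` is a Cauchy name of the point `x`. -/
def IsName (cX : ComputableMetric α X) (p : ℕ → ℕ) (x : X) : Prop :=
  (∀ n m : ℕ, n ≤ m → dist (cX.seq (p n)) (cX.seq (p m)) < 1 / 2 ^ n) ∧
    Filter.Tendsto (fun n => cX.seq (p n)) Filter.atTop (nhds x)

/-- `U` is the union of an `α`-computable sequence of rational open balls. The triple `(n, a, b)`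
codes the ball about `cX.seq n` of radius `a / (b + 1)`; for `a = 0` this ball is empty, so that
empty and finite unions are included. -/
def IsCEOpen (cX : ComputableMetric α X) (U : Set X) : Prop :=
  ∃ f : ℕ → ℕ × ℕ × ℕ, ComputableIn (oracle α) f ∧
    U = ⋃ i : ℕ, Metric.ball (cX.seq (f i).1) (((f i).2.1 : ℝ) / ((f i).2.2 + 1))

/-- `P` is a `Π⁰₁(α)` set: its complement is `α`-c.e. open. -/
def IsPiOne (cX : ComputableMetric α X) (P : Set X) : Prop :=
  IsCEOpen cX Pᶜ

/-- A partial function between `α`-computable metric spaces is `α`-computable if some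
`α`-computable function on Baire space maps each name of each point `x` of the domain to a name of
the value at `x`. -/
def ComputableMap (cX : ComputableMetric α X) (cY : ComputableMetric α Y) (f : X →. Y) : Prop :=
  ∃ Φ : (ℕ → ℕ) →. (ℕ → ℕ), ComputableFunctional α Φ ∧
    ∀ (x : X) (y : Y), y ∈ f x → ∀ p : ℕ → ℕ, IsName cX p x → ∃ q ∈ Φ p, IsName cY q y

/-- `y ≤_tt^α x`: some partial `α`-computable function with `Π⁰₁(α)` domain maps `x` to `y`. -/
def TTReducible (cX : ComputableMetric α X) (cY : ComputableMetric α Y) (y : Y) (x : X) : Prop :=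
  ∃ f : X →. Y, ComputableMap cX cY f ∧ IsPiOne cX f.Dom ∧ y ∈ f x

/-- `y ≡_tt^α x`. -/
def TTEquivalent (cX : ComputableMetric α X) (cY : ComputableMetric α Y) (y : Y) (x : X) : Prop :=
  TTReducible cX cY y x ∧ TTReducible cY cX x y

end

/-! ### Degrees -/

/-- A point of some `α`-computable metric space. -/
structure Point (α : ℕ → Bool) : Type (u + 1) where
  /-- the space -/
  Space : Type u
  [metric : MetricSpace Space]
  /-- its structure of an `α`-computable metric space -/
  computableMetric : ComputableMetric α Space
  /-- the point -/
  pt : Space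

attribute [instance] Point.metric

/-- The `α`-relative tt-degree of `x`: the class of all points, of all `α`-computable metric
spaces, that are tt-equivalent to `x` relative to `α`. -/
def ttDegree {α : ℕ → Bool} {X : Type u} [MetricSpace X] (cX : ComputableMetric α X) (x : X) :
    Set (Point.{u} α) :=
  {z | TTEquivalent cX z.computableMetric z.pt x}

/-- The `α`-relative tt-degree structure of `X`: the collection of the degrees of its points. -/
def ttDegrees {α : ℕ → Bool} {X : Type u} [MetricSpace X] (cX : ComputableMetric α X) :
    Set (Set (Point.{u} α)) :=
  Set.range (ttDegree cX)

end TTDegree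

open Set Filter Topology

namespace TTDegree

/-! ### Extension of maps, and the countable closed sum theorem -/

/-! If every degree of `Y` is a degree of `X`, each `y : Y` is exchanged with some `x : X` by two
computable maps `f`, `g` with closed domains. There are only countably many such pairs
(`countable_setOf_computableMap`), and each is continuous on its domain
(`ComputableMap.exists_continuousOn`). So `Y` is a countable union of sets `{y | f (g y) = y}`, each
closed and homeomorphic, via `g`, to a closed subset of `X`.

A sphere that is an absolute extensor of `X` is therefore one for each piece
(`IsAbsoluteExtensor.on_setOf_rightInverse`), and the countable closed sum theorem
`isAbsoluteExtensor_of_iUnion` passes this to `Y`. Hence every `n` admissible in `topDim X` is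
admissible in `topDim Y`, so `topDim Y ≤ topDim X`. This is the contrapositive of (1), and applying
it in both directions gives (2). -/

/-- Relative form of `IsAbsoluteExtensor`: maps to `S` extend from closed subsets of `E` to `E`. -/
def IsAbsoluteExtensorOn (S : Type v) [TopologicalSpace S] {X : Type u} [TopologicalSpace X]
    (E : Set X) : Prop :=
  ∀ K ⊆ E, IsClosed K → ∀ f : X → S, ContinuousOn f K →
    ∃ g : X → S, ContinuousOn g E ∧ EqOn g f K

/-- `S` is an absolute neighbourhood extensor of `X`. -/
def IsNeighborhoodExtensor (S : Type v) [TopologicalSpace S] (X : Type u) [TopologicalSpace X] :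
    Prop :=
  ∀ (K : Set X) (f : X → S), IsClosed K → ContinuousOn f K →
    ∃ (N : Set X) (g : X → S), IsClosed N ∧ K ⊆ interior N ∧ ContinuousOn g N ∧ EqOn g f K

theorem IsAbsoluteExtensor.exists_extension {S : Type v} [TopologicalSpace S] {X : Type u}
    [TopologicalSpace X] (h : IsAbsoluteExtensor S X) {K : Set X} (hK : IsClosed K) {f : X → S}
    (hf : ContinuousOn f K) : ∃ g : X → S, Continuous g ∧ EqOn g f K := by
  obtain ⟨g, hg⟩ := h K hK ⟨fun x => f x, continuousOn_iff_continuous_domRestrict.1 hf⟩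
  exact ⟨g, g.continuous, fun x hx => hg ⟨x, hx⟩⟩

theorem isAbsoluteExtensor_of_forall {S : Type v} [TopologicalSpace S] [Nonempty S] {X : Type u}
    [TopologicalSpace X] (h : ∀ K : Set X, IsClosed K → ∀ f : X → S, ContinuousOn f K →
      ∃ g : X → S, Continuous g ∧ EqOn g f K) : IsAbsoluteExtensor S X := by
  classical
  intro K hK f
  set F : X → S := fun x => if hx : x ∈ K then f ⟨x, hx⟩ else Classical.arbitrary S with hF
  have hFK : ∀ x : K, F x = f x := fun x => by simp [hF]
  obtain ⟨g, hg, hgF⟩ := h K hK F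
    (continuousOn_iff_continuous_domRestrict.2 (f.continuous.congr fun x => (hFK x).symm))
  exact ⟨⟨g, hg⟩, fun x => (hgF x.2).trans (hFK x)⟩

/-- Tietze extends the map into Euclidean space; where the extension stays away from the origin,
radial projection brings it back to the sphere. -/
theorem isNeighborhoodExtensor_sphere (n : ℕ) (X : Type u) [TopologicalSpace X] [NormalSpace X] :
    IsNeighborhoodExtensor (Sphere n) X := by
  classical
  intro K f hK hf
  have : TietzeExtension.{u} (EuclideanSpace ℝ (Fin (n + 1))) := TietzeExtension.of_tvs ℝ
  obtain ⟨F, hF⟩ := ContinuousMap.exists_restrict_eq hK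
    (⟨fun x => (f x : EuclideanSpace ℝ (Fin (n + 1))),
      continuous_subtype_val.comp (continuousOn_iff_continuous_domRestrict.1 hf)⟩ : C(K, _))
  have hFK : ∀ x ∈ K, F x = f x := fun x hx => congrArg (fun G => G ⟨x, hx⟩) hF
  by_cases hne : K.Nonempty
  swap
  · rw [not_nonempty_iff_eq_empty] at hne
    subst hne
    exact ⟨∅, f, isClosed_empty, empty_subset _, continuousOn_empty _, eqOn_empty _ _⟩
  obtain ⟨x₀, -⟩ := hne
  -- The value at zeros of `F` is arbitrary: they lie outside the neighbourhood chosen below.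
  set g : X → Sphere n := fun x =>
    if hx : F x = 0 then f x₀ else ⟨‖F x‖⁻¹ • F x, by simp [norm_smul, hx]⟩ with hg
  have hgv : ∀ x, F x ≠ 0 → (g x : EuclideanSpace ℝ (Fin (n + 1))) = ‖F x‖⁻¹ • F x :=
    fun x hx => by simp [hg, hx]
  have hN : ∀ x ∈ {x | 1 / 2 ≤ ‖F x‖}, F x ≠ 0 := fun x hx h0 => by
    rw [mem_ofPred_eq, h0, norm_zero] at hx
    norm_num at hx
  have h1 : ∀ x ∈ K, ‖F x‖ = 1 := fun x hx => by
    rw [hFK x hx]; exact mem_sphere_zero_iff_norm.1 (f x).2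
  -- Any threshold strictly between 0 and 1 would do, since `‖F x‖ = 1` on `K`.
  refine ⟨{x | 1 / 2 ≤ ‖F x‖}, g, isClosed_le continuous_const F.continuous.norm, ?_, ?_, ?_⟩
  · refine fun x hx => interior_maximal (s := {x | 1 / 2 ≤ ‖F x‖}) (t := {x | 1 / 2 < ‖F x‖})
      (fun y hy => le_of_lt (b := ‖F y‖) hy) (isOpen_lt continuous_const F.continuous.norm) ?_
    rw [mem_ofPred_eq, h1 x hx]; norm_num
  · rw [Topology.IsInducing.subtypeVal.continuousOn_iff]
    refine ContinuousOn.congr (f := fun x => ‖F x‖⁻¹ • F x) ?_ fun x hx => hgv x (hN x hx)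
    exact (F.continuous.norm.continuousOn.inv₀ fun x hx => norm_ne_zero_iff.2 (hN x hx)).smul
      F.continuous.continuousOn
  · intro x hx
    apply Subtype.ext
    rw [hgv x (norm_ne_zero_iff.1 (by rw [h1 x hx]; exact one_ne_zero)), h1 x hx, inv_one,
      one_smul, hFK x hx]

/-- A map on a closed set extends to a neighbourhood of that set together with any closed set
for which `S` is an absolute extensor. -/
theorem IsAbsoluteExtensorOn.exists_extension_union {S : Type v} [TopologicalSpace S] {X : Type u}
    [TopologicalSpace X] (hS : IsNeighborhoodExtensor S X) {P : Set X} (hP : IsClosed P)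
    (h : IsAbsoluteExtensorOn S P) {K : Set X} (hK : IsClosed K) {f : X → S}
    (hf : ContinuousOn f K) :
    ∃ (N : Set X) (g : X → S), IsClosed N ∧ K ∪ P ⊆ interior N ∧ ContinuousOn g N ∧
      EqOn g f K := by
  classical
  obtain ⟨g, hg, hgf⟩ := h (K ∩ P) inter_subset_right (hK.inter hP) f (hf.mono inter_subset_left)
  have hK' : EqOn (K.piecewise f g) f K := piecewise_eqOn K f g
  have hP' : EqOn (K.piecewise f g) g P := fun x hx => by
    by_cases hxK : x ∈ K
    · rw [piecewise_eq_of_mem _ _ _ hxK, hgf ⟨hxK, hx⟩]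
    · rw [piecewise_eq_of_notMem _ _ _ hxK]
  obtain ⟨N, F, hN, hKN, hF, hFf⟩ := hS (K ∪ P) (K.piecewise f g) (hK.union hP)
    ((hf.congr hK').union_of_isClosed (hg.congr hP') hK hP)
  exact ⟨N, F, hN, hKN, hF, (hFf.mono subset_union_left).trans hK'⟩

/-- The countable closed sum theorem. -/
theorem isAbsoluteExtensor_of_iUnion {S : Type v} [TopologicalSpace S] [Nonempty S] {X : Type u}
    [TopologicalSpace X] (hS : IsNeighborhoodExtensor S X) (P : ℕ → Set X)
    (hP : ∀ i, IsClosed (P i)) (h : ∀ i, IsAbsoluteExtensorOn S (P i)) (hU : ∀ x, ∃ i, x ∈ P i) :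
    IsAbsoluteExtensor S X := by
  refine isAbsoluteExtensor_of_forall fun K hK f hf => ?_
  let T := {s : Set X × (X → S) // IsClosed s.1 ∧ ContinuousOn s.2 s.1}
  have step : ∀ (i : ℕ) (s : T), ∃ s' : T, s.1.1 ∪ P i ⊆ interior s'.1.1 ∧
      EqOn s'.1.2 s.1.2 s.1.1 := by
    rintro i ⟨⟨N, f⟩, hN, hf⟩
    obtain ⟨N', g, hN', hsub, hg, hgf⟩ := (h i).exists_extension_union hS (hP i) hN hf
    exact ⟨⟨⟨N', g⟩, hN', hg⟩, hsub, hgf⟩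
  choose next hsub heq using step
  -- Stage `i + 1` swallows `P i` into its interior. Having interiors is what makes the union of the
  -- partial extensions continuous.
  let s : ℕ → T := fun i => Nat.rec ⟨⟨K, f⟩, hK, hf⟩ next i
  have hmono : Monotone fun i => (s i).1.1 := monotone_nat_of_le_succ fun i =>
    (subset_union_left.trans (hsub i (s i))).trans interior_subset
  have heq' : ∀ i j, i ≤ j → EqOn (s j).1.2 (s i).1.2 (s i).1.1 := by
    intro i j hij
    induction j, hij using Nat.le_induction with
    | base => exact eqOn_refl _ _
    | succ j hij ih => exact fun x hx => (heq j (s j) (hmono hij hx)).trans (ih hx)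
  have hint : ∀ x, ∃ i, x ∈ interior (s i).1.1 := fun x =>
    let ⟨i, hi⟩ := hU x
    ⟨i + 1, hsub i (s i) (Or.inr hi)⟩
  choose idx hidx using hint
  have hg : ∀ i, EqOn (fun x => (s (idx x)).1.2 x) (s i).1.2 (s i).1.1 := by
    intro i x hx
    rcases le_total i (idx x) with hle | hle
    · exact heq' _ _ hle hx
    · exact (heq' _ _ hle (interior_subset (hidx x))).symm
  refine ⟨fun x => (s (idx x)).1.2 x, continuous_iff_continuousAt.2 fun x => ?_, hg 0⟩
  have hnhds : (s (idx x)).1.1 ∈ 𝓝 x := mem_interior_iff_mem_nhds.1 (hidx x)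
  exact ((s (idx x)).2.2.congr (hg _)).continuousAt hnhds

/-- Agreement of two continuous maps into a Hausdorff space is a closed condition on `E ∩ G ⁻¹' D`,
which is itself closed because `G` is continuous on the closed set `E`. -/
theorem isClosed_setOf_rightInverse {X : Type u} {Y : Type v} [TopologicalSpace X]
    [TopologicalSpace Y] [T2Space Y] {F : X → Y} {G : Y → X} {D : Set X} {E : Set Y}
    (hD : IsClosed D) (hE : IsClosed E) (hF : ContinuousOn F D) (hG : ContinuousOn G E) :
    IsClosed {y | y ∈ E ∧ G y ∈ D ∧ F (G y) = y} := by
  have hA : IsClosed (E ∩ G ⁻¹' D) := hG.preimage_isClosed_of_isClosed hE hD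
  have hc : ContinuousOn (fun y => (F (G y), y)) (E ∩ G ⁻¹' D) :=
    (hF.comp (hG.mono inter_subset_left) fun y hy => hy.2).prodMk continuousOn_id
  convert hc.preimage_isClosed_of_isClosed hA isClosed_diagonal using 1
  ext y
  simp only [mem_ofPred_eq, mem_inter_iff, mem_preimage, mem_diagonal_iff, and_assoc]

/-- Absolute extensors pass to closed sets that are homeomorphic to closed subsets. -/
theorem IsAbsoluteExtensor.on_setOf_rightInverse {S : Type*} [TopologicalSpace S] {X : Type u}
    {Y : Type v} [TopologicalSpace X] [T2Space X] [TopologicalSpace Y]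
    (h : IsAbsoluteExtensor S X) {F : X → Y} {G : Y → X} {D : Set X} {E : Set Y}
    (hD : IsClosed D) (hE : IsClosed E) (hF : ContinuousOn F D) (hG : ContinuousOn G E) :
    IsAbsoluteExtensorOn S {y | y ∈ E ∧ G y ∈ D ∧ F (G y) = y} := by
  intro K hKP hK f hf
  -- `Q` is the mirror image in `X` of the given set: `F` and `G` restrict to mutually inverse
  -- homeomorphisms between the two. The extension problem is pulled back along `F`, solved on `X`,
  -- and returned along `G`.
  set Q : Set X := {x | x ∈ D ∧ F x ∈ E ∧ G (F x) = x}
  have hQ : IsClosed Q := isClosed_setOf_rightInverse hE hD hG hF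
  have hFQ : ContinuousOn F Q := hF.mono fun x hx => hx.1
  obtain ⟨H, hH, hHf⟩ := h.exists_extension (f := f ∘ F)
    (hFQ.preimage_isClosed_of_isClosed hQ hK)
    (hf.comp (hFQ.mono inter_subset_left) fun x hx => hx.2)
  refine ⟨H ∘ G, hH.comp_continuousOn (hG.mono fun y hy => hy.1), fun y hy => ?_⟩
  obtain ⟨hyE, hyD, hFG⟩ := hKP hy
  have hmem : G y ∈ Q ∩ F ⁻¹' K := ⟨⟨hyD, by rwa [hFG], by rw [hFG]⟩, by rwa [mem_preimage, hFG]⟩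
  rw [Function.comp_apply, hHf hmem, Function.comp_apply, hFG]

/-! ### Countability of the computable functions -/

/-- The functions obtained from those in `O` by at most `n` rounds of the closure operations of
`Nat.RecursiveIn`. -/
def recursiveStage (O : Set (ℕ →. ℕ)) : ℕ → Set (ℕ →. ℕ)
  | 0 => {fun _ => 0, ((Nat.succ : ℕ → ℕ) : ℕ →. ℕ), ((fun n => (Nat.unpair n).1 : ℕ → ℕ) : ℕ →. ℕ),
      ((fun n => (Nat.unpair n).2 : ℕ → ℕ) : ℕ →. ℕ)} ∪ O
  | k + 1 => recursiveStage O k ∪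
      (image2 (fun f h n => Nat.pair <$> f n <*> h n) (recursiveStage O k) (recursiveStage O k) ∪
      (image2 (fun f h n => h n >>= f) (recursiveStage O k) (recursiveStage O k) ∪
      (image2 (fun f h p =>
        let (a, n) := Nat.unpair p
        n.rec (f a) fun y IH => do
          let i ← IH
          h (Nat.pair a (Nat.pair y i))) (recursiveStage O k) (recursiveStage O k) ∪
      (fun f a => Nat.rfind fun n => (fun m => m = 0) <$> f (Nat.pair a n)) ''
        recursiveStage O k)))

theorem countable_recursiveStage {O : Set (ℕ →. ℕ)} (hO : O.Countable) (k : ℕ) :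
    (recursiveStage O k).Countable := by
  induction k with
  | zero => exact ((((countable_singleton _).insert _).insert _).insert _).union hO
  | succ k ih =>
    exact ih.union ((ih.image2 ih _).union ((ih.image2 ih _).union ((ih.image2 ih _).union
      (ih.image _))))

theorem monotone_recursiveStage (O : Set (ℕ →. ℕ)) : Monotone (recursiveStage O) :=
  monotone_nat_of_le_succ fun _ => subset_union_left

theorem exists_mem_recursiveStage {O : Set (ℕ →. ℕ)} {f : ℕ →. ℕ} (hf : Nat.RecursiveIn O f) :
    ∃ k, f ∈ recursiveStage O k := by
  have join : ∀ {f h : ℕ →. ℕ}, (∃ k, f ∈ recursiveStage O k) → (∃ k, h ∈ recursiveStage O k) →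
      ∃ k, f ∈ recursiveStage O k ∧ h ∈ recursiveStage O k := by
    rintro f h ⟨k, hk⟩ ⟨l, hl⟩
    exact ⟨max k l, monotone_recursiveStage O (le_max_left k l) hk,
      monotone_recursiveStage O (le_max_right k l) hl⟩
  induction hf with
  | zero => exact ⟨0, Or.inl (Or.inl rfl)⟩
  | succ => exact ⟨0, Or.inl (Or.inr (Or.inl rfl))⟩
  | left => exact ⟨0, Or.inl (Or.inr (Or.inr (Or.inl rfl)))⟩
  | right => exact ⟨0, Or.inl (Or.inr (Or.inr (Or.inr rfl)))⟩
  | oracle g hg => exact ⟨0, Or.inr hg⟩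
  | pair _ _ ihf ihh =>
    obtain ⟨k, hf, hh⟩ := join ihf ihh
    exact ⟨k + 1, Or.inr (Or.inl ⟨_, hf, _, hh, rfl⟩)⟩
  | comp _ _ ihf ihh =>
    obtain ⟨k, hf, hh⟩ := join ihf ihh
    exact ⟨k + 1, Or.inr (Or.inr (Or.inl ⟨_, hf, _, hh, rfl⟩))⟩
  | prec _ _ ihf ihh =>
    obtain ⟨k, hf, hh⟩ := join ihf ihh
    exact ⟨k + 1, Or.inr (Or.inr (Or.inr (Or.inl ⟨_, hf, _, hh, rfl⟩)))⟩
  | rfind _ ihf =>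
    obtain ⟨k, hf⟩ := ihf
    exact ⟨k + 1, Or.inr (Or.inr (Or.inr (Or.inr ⟨_, hf, rfl⟩)))⟩

theorem countable_setOf_nat_recursiveIn {O : Set (ℕ →. ℕ)} (hO : O.Countable) :
    {f | Nat.RecursiveIn O f}.Countable :=
  (countable_iUnion (countable_recursiveStage hO)).mono fun _ hf =>
    mem_iUnion.2 (exists_mem_recursiveStage hf)

theorem countable_setOf_computableIn {β σ : Type*} [Primcodable β] [Primcodable σ]
    {O : Set (ℕ →. ℕ)} (hO : O.Countable) : {φ : β → σ | ComputableIn O φ}.Countable := by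
  -- `ComputableIn O φ` unfolds to recursiveness of this function on codes, which determines `φ`.
  refine MapsTo.countable_of_injOn (f := fun φ n => Part.bind
    (Encodable.decode (α := β) n : Part β) fun a => (Part.some (φ a)).map Encodable.encode)
    (fun φ hφ => hφ) (fun φ _ ψ _ h => ?_) (countable_setOf_nat_recursiveIn hO)
  funext a
  simpa using congrFun h (Encodable.encode a)

/-! ### Names -/

theorem initSeg_prefix (p : ℕ → ℕ) {k l : ℕ} (h : k ≤ l) : initSeg p k <+: initSeg p l := by
  obtain ⟨m, rfl⟩ := Nat.exists_eq_add_of_le h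
  simp [initSeg, List.range_add]

theorem initSeg_congr {p q : ℕ → ℕ} {k : ℕ} (h : ∀ i < k, p i = q i) :
    initSeg p k = initSeg q k :=
  List.map_congr_left fun i hi => h i (List.mem_range.1 hi)

theorem eq_of_initSeg_eq {p q : ℕ → ℕ} {k : ℕ} (h : initSeg p k = initSeg q k) {i : ℕ}
    (hi : i < k) : p i = q i :=
  List.map_inj_left.1 h i (List.mem_range.2 hi)

/-- Initial segments of values that are forced by initial segments of the same argument agree. -/
theorem initSeg_eq_of_prefix {φ : List ℕ → List ℕ}
    (hφ : ∀ σ τ : List ℕ, σ <+: τ → φ σ <+: φ τ) {p q q' : ℕ → ℕ} {n k k' : ℕ}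
    (h : initSeg q n <+: φ (initSeg p k)) (h' : initSeg q' n <+: φ (initSeg p k')) :
    initSeg q n = initSeg q' n := by
  have hk := h.trans (hφ _ _ (initSeg_prefix p (le_max_left k k')))
  have hk' := h'.trans (hφ _ _ (initSeg_prefix p (le_max_right k k')))
  exact (List.prefix_of_prefix_length_le hk hk' (by simp [initSeg])).eq_of_length
    (by simp [initSeg])

section

variable {α : ℕ → Bool} {X : Type u} [MetricSpace X] {Y : Type v} [MetricSpace Y]

/-- The bound has half the precision demanded of a name, so the triangle inequality suffices. Unlike
being a name, it is an open condition on `x` for each entry separately, which the continuity proof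
exploits. -/
theorem isName_of_dist_lt (cX : ComputableMetric α X) {p : ℕ → ℕ} {x : X}
    (h : ∀ n, dist (cX.seq (p n)) x < 1 / 2 ^ (n + 1)) : IsName cX p x := by
  refine ⟨fun n m hnm => ?_, ?_⟩
  · have hm : (1 : ℝ) / 2 ^ (m + 1) ≤ 1 / 2 ^ (n + 1) :=
      one_div_le_one_div_of_le (by positivity) (pow_le_pow_right₀ one_le_two (by omega))
    have hn : (1 : ℝ) / 2 ^ (n + 1) + 1 / 2 ^ (n + 1) = 1 / 2 ^ n := by
      rw [pow_succ]; field_simp; norm_num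
    have := dist_triangle_right (cX.seq (p n)) (cX.seq (p m)) x
    linarith [h n, h m]
  · rw [tendsto_iff_dist_tendsto_zero]
    refine squeeze_zero (fun _ => dist_nonneg) (fun n => (h n).le) ?_
    have := (tendsto_add_atTop_iff_nat 1).2
      (tendsto_pow_atTop_nhds_zero_of_lt_one (r := (1 / 2 : ℝ)) (by norm_num) (by norm_num))
    simpa only [one_div, inv_pow] using this

theorem exists_dist_seq_lt (cX : ComputableMetric α X) (x : X) (n : ℕ) :
    ∃ m, dist (cX.seq m) x < 1 / 2 ^ (n + 1) := by
  obtain ⟨m, hm⟩ := cX.dense.exists_dist_lt x (ε := 1 / 2 ^ (n + 1)) (by positivity)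
  exact ⟨m, by rwa [dist_comm]⟩

theorem exists_isName (cX : ComputableMetric α X) (x : X) : ∃ p, IsName cX p x := by
  choose p hp using exists_dist_seq_lt cX x
  exact ⟨p, isName_of_dist_lt cX hp⟩

theorem IsName.dist_le {cX : ComputableMetric α X} {p : ℕ → ℕ} {x : X} (h : IsName cX p x)
    (n : ℕ) : dist (cX.seq (p n)) x ≤ 1 / 2 ^ n :=
  le_of_tendsto (tendsto_const_nhds.dist h.2)
    ((eventually_ge_atTop n).mono fun m hm => (h.1 n m hm).le)

theorem IsCEOpen.isOpen {cX : ComputableMetric α X} {U : Set X} (h : IsCEOpen cX U) :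
    IsOpen U := by
  obtain ⟨f, -, rfl⟩ := h
  exact isOpen_iUnion fun _ => Metric.isOpen_ball

theorem IsPiOne.isClosed {cX : ComputableMetric α X} {P : Set X} (h : IsPiOne cX P) :
    IsClosed P :=
  isOpen_compl_iff.1 (IsCEOpen.isOpen h)

/-! ### Computable maps -/

/-- A computable map is continuous on its domain. -/
theorem ComputableMap.exists_continuousOn {cX : ComputableMetric α X} {cY : ComputableMetric α Y}
    {f : X →. Y} (h : ComputableMap cX cY f) :
    ∃ F : X → Y, ContinuousOn F f.Dom ∧ ∀ x y, y ∈ f x ↔ x ∈ f.Dom ∧ F x = y := by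
  classical
  obtain ⟨Φ, ⟨φ, -, hmono, hφ⟩, hΦ⟩ := h
  set F : X → Y := fun x => if hx : (f x).Dom then (f x).get hx else cY.seq 0 with hFdef
  have hF : ∀ x y, y ∈ f x ↔ x ∈ f.Dom ∧ F x = y := by
    refine fun x y => ⟨?_, ?_⟩
    · rintro ⟨hx, rfl⟩
      exact ⟨hx, by simp [hFdef, hx]⟩
    · rintro ⟨hx, rfl⟩
      have hx' : (f x).Dom := hx
      simpa [hFdef, hx'] using Part.get_mem hx'
  refine ⟨F, fun x hx => Metric.continuousWithinAt_iff'.2 fun ε hε => ?_, hF⟩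
  obtain ⟨n, hn⟩ : ∃ n : ℕ, (1 / 2 : ℝ) ^ n < ε / 2 :=
    exists_pow_lt_of_lt_one (half_pos hε) (by norm_num)
  rw [one_div_pow] at hn
  choose p hp using exists_dist_seq_lt cX x
  obtain ⟨q, hqΦ, hq⟩ := hΦ x _ ((hF x _).2 ⟨hx, rfl⟩) p (isName_of_dist_lt cX hp)
  -- Length `n + 1` is needed to fix the entry `q n`; only the first `k` entries of `p` are used.
  obtain ⟨k, hk⟩ := (hφ p q).1 hqΦ (n + 1)
  have hnear : ∀ᶠ x' in 𝓝[f.Dom] x, ∀ i ∈ Finset.range k,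
      dist (cX.seq (p i)) x' < 1 / 2 ^ (i + 1) := by
    rw [Filter.eventually_all_finset]
    refine fun i _ => eventually_nhdsWithin_of_eventually_nhds ?_
    exact (continuous_const.dist continuous_id).continuousAt.eventually_lt_const (hp i)
  filter_upwards [hnear, self_mem_nhdsWithin] with x' hx' hx'D
  choose r hr using exists_dist_seq_lt cX x'
  -- A name of `x'` that starts with the first `k` entries of `p`; it forces the same `q n`, so `F
  -- x` and `F x'` are both within `1 / 2 ^ n` of `cY.seq (q n)`.
  have hp' : ∀ i, dist (cX.seq (if i < k then p i else r i)) x' < 1 / 2 ^ (i + 1) := fun i => by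
    split_ifs with hi
    · exact hx' i (Finset.mem_range.2 hi)
    · exact hr i
  obtain ⟨q', hqΦ', hq'⟩ := hΦ x' _ ((hF x' _).2 ⟨hx'D, rfl⟩) _ (isName_of_dist_lt cX hp')
  obtain ⟨k', hk'⟩ := (hφ _ q').1 hqΦ' (n + 1)
  rw [initSeg_congr (q := fun i => if i < k then p i else r i)
    fun i hi => (if_pos hi).symm] at hk
  have hqq : q n = q' n := eq_of_initSeg_eq (initSeg_eq_of_prefix hmono hk hk') n.lt_succ_self
  have h1 := hq.dist_le n
  have h2 := hq'.dist_le n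
  rw [← hqq] at h2
  have := dist_triangle_left (F x') (F x) (cY.seq (q n))
  linarith

/-- There are only countably many computable maps with `Π⁰₁` domain. -/
theorem countable_setOf_computableMap (cX : ComputableMetric α X) (cY : ComputableMetric α Y) :
    {f : X →. Y | ComputableMap cX cY f ∧ IsPiOne cX f.Dom}.Countable := by
  have hO : (oracle α).Countable := countable_singleton _
  -- A map is coded by its string function and the ball sequence of its complement. The code
  -- determines it: the balls give the domain, and the string function gives the values, as limits
  -- of output names.
  have hex : ∀ f : {f : X →. Y | ComputableMap cX cY f ∧ IsPiOne cX f.Dom},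
      ∃ c : (List ℕ → List ℕ) × (ℕ → ℕ × ℕ × ℕ),
      c ∈ {φ | ComputableIn (oracle α) φ} ×ˢ {u | ComputableIn (oracle α) u} ∧
      (∃ Φ : (ℕ → ℕ) →. (ℕ → ℕ), (∀ p q : ℕ → ℕ, q ∈ Φ p ↔
        ∀ n : ℕ, ∃ k : ℕ, initSeg q n <+: c.1 (initSeg p k)) ∧
        ∀ (x : X) (y : Y), y ∈ f.1 x → ∀ p, IsName cX p x → ∃ q ∈ Φ p, IsName cY q y) ∧
      (f.1.Dom)ᶜ = ⋃ i : ℕ,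
        Metric.ball (cX.seq (c.2 i).1) (((c.2 i).2.1 : ℝ) / ((c.2 i).2.2 + 1)) := by
    rintro ⟨f, ⟨Φ, ⟨φ, hφ, -, hΦφ⟩, hΦ⟩, ⟨u, hu, hD⟩⟩
    exact ⟨(φ, u), ⟨hφ, hu⟩, ⟨Φ, hΦφ, hΦ⟩, hD⟩
  choose c hc hΦ hD using hex
  rw [← countable_coe_iff, ← countable_univ_iff]
  refine MapsTo.countable_of_injOn (f := c) (fun f _ => hc f) (fun f _ g _ hfg => ?_)
    ((countable_setOf_computableIn hO).prod (countable_setOf_computableIn hO))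
  have hdom : f.1.Dom = g.1.Dom := by
    rw [← compl_inj_iff, hD f, hD g, hfg]
  obtain ⟨Φ, hΦφ, hf⟩ := hΦ f
  obtain ⟨Ψ, hΨφ, hg⟩ := hΦ g
  have hΦΨ : Φ = Ψ := by
    ext p q
    rw [hΦφ, hΨφ, hfg]
  subst hΦΨ
  have huniq : ∀ x y z, y ∈ f.1 x → z ∈ g.1 x → y = z := by
    intro x y z hy hz
    obtain ⟨p, hp⟩ := exists_isName cX x
    obtain ⟨q, hq, hqy⟩ := hf x y hy p hp
    obtain ⟨q', hq', hqz⟩ := hg x z hz p hp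
    obtain rfl := Part.mem_unique hq hq'
    exact tendsto_nhds_unique hqy.2 hqz.2
  apply Subtype.ext
  ext x y
  constructor
  · intro hy
    have hx : x ∈ g.1.Dom := hdom ▸ Part.dom_iff_mem.2 ⟨y, hy⟩
    obtain ⟨z, hz⟩ := Part.dom_iff_mem.1 hx
    rwa [huniq x y z hy hz]
  · intro hy
    have hx : x ∈ f.1.Dom := hdom ▸ Part.dom_iff_mem.2 ⟨y, hy⟩
    obtain ⟨z, hz⟩ := Part.dom_iff_mem.1 hx
    rwa [← huniq x z y hz hy]

theorem TTReducible.refl (cX : ComputableMetric α X) (x : X) : TTReducible cX cX x x := by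
  -- The balls coded by `(0, 0, 0)` have radius 0 and are empty, so the domain is the whole space.
  refine ⟨fun x => Part.some x, ⟨fun p => Part.some p, ⟨id, ComputableIn.id, fun _ _ h => h,
    fun p q => ?_⟩, ?_⟩, ⟨fun _ => (0, 0, 0), ComputableIn.const _, ?_⟩, Part.mem_some x⟩
  · rw [Part.mem_some_iff]
    refine ⟨?_, fun h => ?_⟩
    · rintro rfl n
      exact ⟨n, List.prefix_rfl⟩
    · funext i
      obtain ⟨k, hk⟩ := h (i + 1)
      exact eq_of_initSeg_eq (initSeg_eq_of_prefix (φ := id) (fun _ _ h => h) hk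
        (List.prefix_rfl (l := initSeg p (i + 1)))) i.lt_succ_self
  · intro x y hy p hp
    rw [Part.mem_some_iff] at hy
    exact ⟨p, Part.mem_some p, hy ▸ hp⟩
  · ext x
    simp [PFun.Dom]

/-- If each point of `Y` is tt-equivalent to a point of `X`, then each sphere that is an absolute
extensor of `X` is one of `Y`. -/
theorem IsAbsoluteExtensor.of_forall_ttEquivalent (cX : ComputableMetric α X)
    (cY : ComputableMetric α Y) (h : ∀ y : Y, ∃ x : X, TTEquivalent cX cY y x) {n : ℕ}
    (hX : IsAbsoluteExtensor (Sphere n) X) : IsAbsoluteExtensor (Sphere n) Y := by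
  have : Nonempty (Sphere n) := (NormedSpace.sphere_nonempty.2 zero_le_one).to_subtype
  let T := {f : X →. Y | ComputableMap cX cY f ∧ IsPiOne cX f.Dom} ×ˢ
    {g : Y →. X | ComputableMap cY cX g ∧ IsPiOne cY g.Dom}
  let P : (X →. Y) × (Y →. X) → Set Y := fun t => {y | ∃ x, x ∈ t.2 y ∧ y ∈ t.1 x}
  have hT : T.Countable :=
    (countable_setOf_computableMap cX cY).prod (countable_setOf_computableMap cY cX)
  have hcover : ∀ y, ∃ t ∈ T, y ∈ P t := by
    intro y
    obtain ⟨x, ⟨f, hf, hfD, hfx⟩, ⟨g, hg, hgD, hgy⟩⟩ := h y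
    exact ⟨(f, g), ⟨⟨hf, hfD⟩, ⟨hg, hgD⟩⟩, x, hgy, hfx⟩
  have hP : ∀ t ∈ T, IsClosed (P t) ∧ IsAbsoluteExtensorOn (Sphere n) (P t) := by
    rintro ⟨f, g⟩ ⟨⟨hf, hfD⟩, ⟨hg, hgD⟩⟩
    obtain ⟨F, hF, hfF⟩ := hf.exists_continuousOn
    obtain ⟨G, hG, hgG⟩ := hg.exists_continuousOn
    have hPeq : P (f, g) = {y | y ∈ g.Dom ∧ G y ∈ f.Dom ∧ F (G y) = y} := by
      ext y
      constructor
      · rintro ⟨x, hx, hy⟩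
        obtain ⟨hyD, rfl⟩ := (hgG y x).1 hx
        obtain ⟨hxD, hFy⟩ := (hfF _ y).1 hy
        exact ⟨hyD, hxD, hFy⟩
      · rintro ⟨hyD, hxD, hFy⟩
        exact ⟨G y, (hgG _ _).2 ⟨hyD, rfl⟩, (hfF _ _).2 ⟨hxD, hFy⟩⟩
    rw [hPeq]
    exact ⟨isClosed_setOf_rightInverse hfD.isClosed hgD.isClosed hF hG,
      hX.on_setOf_rightInverse hfD.isClosed hgD.isClosed hF hG⟩
  -- The point `cY.seq 0` shows that `T` is nonempty, as enumerating it by `ℕ` requires.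
  obtain ⟨t₀, ht₀, -⟩ := hcover (cY.seq 0)
  obtain ⟨e, he⟩ := hT.exists_eq_range ⟨t₀, ht₀⟩
  have heT : ∀ i, e i ∈ T := fun i => he ▸ mem_range_self i
  refine isAbsoluteExtensor_of_iUnion (isNeighborhoodExtensor_sphere n Y) (fun i => P (e i))
    (fun i => (hP _ (heT i)).1) (fun i => (hP _ (heT i)).2) fun y => ?_
  obtain ⟨t, ht, hy⟩ := hcover y
  rw [he] at ht
  obtain ⟨i, rfl⟩ := ht
  exact ⟨i, hy⟩

end

/-- Topological dimension is monotone in the structure of the tt-degrees. -/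
theorem topDim_le_of_ttDegrees_subset {α : ℕ → Bool} {X Y : Type u} [MetricSpace X]
    [MetricSpace Y] (cX : ComputableMetric α X) (cY : ComputableMetric α Y)
    (h : ttDegrees cY ⊆ ttDegrees cX) : topDim Y ≤ topDim X := by
  refine le_sInf ?_
  rintro d ⟨n, rfl, hX⟩
  refine sInf_le ⟨n, rfl, hX.of_forall_ttEquivalent cX cY fun y => ?_⟩
  obtain ⟨x, hx⟩ := h (mem_range_self y)
  -- Reflexivity puts `y` in its own degree; since this is also the degree of `x`, the two points
  -- are equivalent.
  have hy : (⟨Y, cY, y⟩ : Point α) ∈ ttDegree cY y := ⟨.refl cY y, .refl cY y⟩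
  rw [← hx] at hy
  exact ⟨x, hy⟩

end TTDegree

theorem corollary2 {X Y : Type u} [MetricSpace X] [PolishSpace X] [MetricSpace Y] [PolishSpace Y]
    (α : ℕ → Bool) (cX : TTDegree.ComputableMetric α X) (cY : TTDegree.ComputableMetric α Y) :
    (TTDegree.topDim X < TTDegree.topDim Y →
      ¬ TTDegree.ttDegrees cY ⊆ TTDegree.ttDegrees cX) ∧
    (TTDegree.ttDegrees cX = TTDegree.ttDegrees cY →
      TTDegree.topDim X = TTDegree.topDim Y) :=
  ⟨fun hlt hsub => (TTDegree.topDim_le_of_ttDegrees_subset cX cY hsub).not_gt hlt,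
    fun heq => le_antisymm (TTDegree.topDim_le_of_ttDegrees_subset cY cX heq.subset)
      (TTDegree.topDim_le_of_ttDegrees_subset cX cY heq.symm.subset)⟩
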